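/- For a complex square matrix $X$ let $\operatorname{ind}(X)$ be the smallest integer $k\ge 0$ with $\operatorname{rank}(X^k)=\operatorname{rank}(X^{k+1})$, let $X^d$ be its Drazin inverse, i.e. the unique matrix with $XX^d=X^dX$, $X^dXX^d=X^d$ and $X^{k}=X^{k+1}X^d$ for $k=\operatorname{ind}(X)$, and write $X^\pi=I-XX^d$, where $I$ is the identity matrix of the proper size. Let $A\in\mathbb{C}^{m\times m}$, $B\in\mathbb{C}^{m\times n}$, $C\in\mathbb{C}^{n\times m}$, $D\in\mathbb{C}^{n\times n}$, and put $$M=\begin{bmatrix}A&B\\ C&D\end{bmatrix},\quad Z=D-CA^dB,\quad W=AA^d+A^dBCA^d,\quad T=\begin{bmatrix}A&B\\ Z^\pi C&Z^\pi D\end{bmatrix},\quad Q=\begin{bmatrix}A^2A^d&AA^dB\\ CAA^d&CA^dB\end{bmatrix},$$ and $g=\operatorname{ind}(T)$. If $BZ=0$, $ZCA^d=0$, $A^\pi BC=0$ and $BCA^\pi=0$, then $$Q^d=\begin{bmatrix}I\\ CA^d\end{bmatrix}\,[(AW)^d]^2A\,\begin{bmatrix}I&A^dB\end{bmatrix}$$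 and $$M^d=\begin{bmatrix}0&0\\ 0&Z^d\end{bmatrix}+Q^d+\sum_{k=0}^{g-1}\begin{bmatrix}0&0\\ (Z^d)^{k+2}C&0\end{bmatrix}T^{k}\,(I-TQ^d),$$ where the sum is $0$ if $g=0$. -/

import Mathlib

/-- The index of a complex square matrix: the smallest `k` with `rank (A ^ k) = rank (A ^ (k + 1))`
(`A ^ 0 = 1`, so invertible matrices have index `0`). -/
noncomputable def matrixIndex {ι : Type*} [Fintype ι] [DecidableEq ι] (A : Matrix ι ι ℂ) : ℕ :=
  sInf {k : ℕ | (A ^ k).rank = (A ^ (k + 1)).rank}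

/-- The set whose infimum is the index is never empty, so the infimum is a genuine minimum. -/
theorem matrixIndex_spec {ι : Type*} [Fintype ι] [DecidableEq ι] (A : Matrix ι ι ℂ) :
    (A ^ matrixIndex A).rank = (A ^ (matrixIndex A + 1)).rank := by
  have hne : {k : ℕ | (A ^ k).rank = (A ^ (k + 1)).rank}.Nonempty := by
    by_contra h
    rw [Set.not_nonempty_iff_eq_empty] at h
    have hlt : ∀ k, (A ^ (k + 1)).rank < (A ^ k).rank := by
      intro k
      have hk : (A ^ k).rank ≠ (A ^ (k + 1)).rank := by
        intro hk
        have : k ∈ {k : ℕ | (A ^ k).rank = (A ^ (k + 1)).rank} := hk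
        rw [h] at this
        exact this
      have hle : (A ^ (k + 1)).rank ≤ (A ^ k).rank := by
        rw [pow_succ]
        exact Matrix.rank_mul_le_left _ _
      omega
    have hsum : ∀ k, (A ^ k).rank + k ≤ (A ^ 0).rank := by
      intro k
      induction k with
      | zero => simp
      | succ k ih => have := hlt k; omega
    have := hsum ((A ^ 0).rank + 1)
    omega
  exact Nat.sInf_mem hne

/-- `X` is a Drazin inverse of `A`:
`A X = X A`, `X A X = X` and `A ^ k = A ^ (k + 1) X`, where `k` is the index of `A`. -/
def IsDrazinInverse {ι : Type*} [Fintype ι] [DecidableEq ι] (A X : Matrix ι ι ℂ) : Prop :=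
  A * X = X * A ∧ X * A * X = X ∧
    A ^ matrixIndex A = A ^ (matrixIndex A + 1) * X

/-- Every complex square matrix has exactly one Drazin inverse. -/
theorem existsUnique_isDrazinInverse {ι : Type*} [Fintype ι] [DecidableEq ι]
    (A : Matrix ι ι ℂ) : ∃! X : Matrix ι ι ℂ, IsDrazinInverse A X := by
  have hrank := matrixIndex_spec A
  unfold IsDrazinInverse
  generalize matrixIndex A = k at hrank ⊢
  have key : ∀ B : Matrix ι ι ℂ, (B ^ k).rank = (B ^ (k + 1)).rank →
      ∃ Y : Matrix ι ι ℂ, B ^ k = B ^ (k + 1) * Y := by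
    intro B hB
    have hrange :
        LinearMap.range (B ^ (k + 1)).mulVecLin = LinearMap.range (B ^ k).mulVecLin := by
      apply Submodule.eq_of_le_of_finrank_eq
      · rw [pow_succ, Matrix.mulVecLin_mul]
        exact LinearMap.range_comp_le_range _ _
      · exact hB.symm
    obtain ⟨f, hf⟩ := Module.projective_lifting_property
      (LinearMap.rangeRestrict (B ^ (k + 1)).mulVecLin)
      ((B ^ k).mulVecLin.codRestrict _ (fun x => by
        rw [hrange]; exact LinearMap.mem_range_self _ x)) (LinearMap.surjective_rangeRestrict _)
    refine ⟨LinearMap.toMatrix' f, ?_⟩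
    apply Matrix.toLin'.injective
    rw [Matrix.toLin'_mul, Matrix.toLin'_toMatrix']
    apply LinearMap.ext
    intro x
    exact (congrArg Subtype.val (LinearMap.congr_fun hf x)).symm
  obtain ⟨Y, hY⟩ := key A hrank
  obtain ⟨Y', hY'⟩ : ∃ Y' : Matrix ι ι ℂ, A ^ k = Y' * A ^ (k + 1) := by
    obtain ⟨U, hU⟩ := key A.transpose (by
      rw [← Matrix.transpose_pow, ← Matrix.transpose_pow, Matrix.rank_transpose,
        Matrix.rank_transpose, hrank])
    refine ⟨U.transpose, ?_⟩
    apply Matrix.transpose_injective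
    rw [Matrix.transpose_mul, Matrix.transpose_transpose, Matrix.transpose_pow,
      Matrix.transpose_pow, hU]
  have hr : ∀ j, A ^ (k + j) * Y ^ j = A ^ k := by
    intro j
    induction j with
    | zero => simp
    | succ j ih =>
      calc A ^ (k + (j + 1)) * Y ^ (j + 1) = A ^ j * (A ^ (k + 1) * Y) * Y ^ j := by
            rw [show k + (j + 1) = j + (k + 1) by ring, pow_add A j, pow_succ' Y]
            simp only [mul_assoc]
        _ = A ^ k := by rw [← hY, ← pow_add, add_comm j k, ih]
  have hl : ∀ j, Y' ^ j * A ^ (k + j) = A ^ k := by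
    intro j
    induction j with
    | zero => simp
    | succ j ih =>
      calc Y' ^ (j + 1) * A ^ (k + (j + 1)) = Y' ^ j * (Y' * A ^ (k + 1)) * A ^ j := by
            rw [show k + (j + 1) = (k + 1) + j by ring, pow_add A (k + 1), pow_succ Y']
            simp only [mul_assoc]
        _ = A ^ k := by rw [← hY', mul_assoc, ← pow_add, ih]
  have hX : A ^ k * Y ^ (k + 1) = Y' ^ (k + 1) * A ^ k := by
    conv_lhs => rw [← hl (k + 1)]
    rw [mul_assoc, hr]
  have hE : A ^ k * Y ^ k = Y' ^ k * A ^ k := by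
    conv_lhs => rw [← hl k]
    rw [mul_assoc, hr]
  have hAX : A * (A ^ k * Y ^ (k + 1)) = A ^ k * Y ^ k := by
    rw [pow_succ' Y, ← mul_assoc, ← mul_assoc, ← pow_succ', ← hY]
  have hXA : A ^ k * Y ^ (k + 1) * A = Y' ^ k * A ^ k := by
    rw [hX, pow_succ Y', mul_assoc, mul_assoc, ← pow_succ, ← hY']
  refine existsUnique_of_exists_of_unique ⟨A ^ k * Y ^ (k + 1), ?_, ?_, ?_⟩ ?_
  · rw [hAX, hXA, hE]
  · rw [mul_assoc, hAX]
    conv_lhs => rw [hX]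
    rw [mul_assoc, ← mul_assoc (A ^ k), ← pow_add, hr, hX]
  · rw [← mul_assoc, ← pow_add, show k + 1 + k = k + (k + 1) by ring, hr]
  · rintro X X' ⟨h1, h2, h3⟩ ⟨h1', h2', h3'⟩
    have hi : (A * X) ^ (k + 1) = A * X :=
      IsIdempotentElem.pow_succ_eq k (by rw [IsIdempotentElem, mul_assoc, ← mul_assoc X, h2])
    have hi' : (A * X') ^ (k + 1) = A * X' :=
      IsIdempotentElem.pow_succ_eq k (by rw [IsIdempotentElem, mul_assoc, ← mul_assoc X', h2'])
    have hc : Commute A X := h1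
    have hc' : Commute A X' := h1'
    have hE1 : A * X = (A * X') * (A * X) := by
      have hk : A ^ (k + 1) = (A * X') * A ^ (k + 1) := by
        conv_lhs => rw [pow_succ', h3', ((hc'.pow_left (k + 1)).eq), ← mul_assoc]
      calc A * X = A ^ (k + 1) * X ^ (k + 1) := by rw [← hc.mul_pow, hi]
        _ = (A * X') * (A ^ (k + 1) * X ^ (k + 1)) := by rw [← mul_assoc, ← hk]
        _ = _ := by rw [← hc.mul_pow, hi]
    have hE2 : A * X' = (A * X') * (A * X) := by
      have hk : A ^ (k + 1) = A ^ (k + 1) * (A * X) := by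
        conv_lhs => rw [pow_succ, h3, mul_assoc, ← h1]
      calc A * X' = X' ^ (k + 1) * A ^ (k + 1) := by rw [h1', ← hc'.symm.mul_pow, ← h1', hi']
        _ = (X' ^ (k + 1) * A ^ (k + 1)) * (A * X) := by rw [mul_assoc, ← hk]
        _ = _ := by rw [← hc'.symm.mul_pow, ← h1', hi']
    have hE : A * X = A * X' := hE1.trans hE2.symm
    calc X = (A * X) * X := by rw [h1, h2]
      _ = X' * (A * X) := by rw [← mul_assoc, ← h1', ← hE]
      _ = X' := by rw [hE, ← mul_assoc, h2']

/-- The Drazin inverse `A ^ d` of a complex square matrix. -/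
noncomputable def drazinInverse {ι : Type*} [Fintype ι] [DecidableEq ι]
    (A : Matrix ι ι ℂ) : Matrix ι ι ℂ :=
  (existsUnique_isDrazinInverse A).choose

/-- `A ^ π = I - A A ^ d`. -/
noncomputable def drazinPi {ι : Type*} [Fintype ι] [DecidableEq ι]
    (A : Matrix ι ι ℂ) : Matrix ι ι ℂ :=
  1 - A * drazinInverse A

/-- The defining equations of the Drazin inverse. -/
theorem drazinInverse_spec {ι : Type*} [Fintype ι] [DecidableEq ι] (A : Matrix ι ι ℂ) :
    IsDrazinInverse A (drazinInverse A) :=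
  (existsUnique_isDrazinInverse A).choose_spec.1

/-! Write a, z for the Drazin inverses of A, Z. Splitting the bottom row of M by the idempotent Zz
gives M = T + N, where N carries the Zz part. The hypotheses force TN = 0 and make N group
invertible, with an explicit group inverse U. Then `IsDrazinInv.add_of_mul_eq_zero` yields the
Drazin inverse of M as (1 - NU)T^d plus the sum of U^(k+1) T^k (1 - T T^d).

It remains to find T^d. The difference T - Q is nilpotent and annihilates Q on both sides, so T^d =
Q^d (`IsDrazinInv.fromBlocks_of_rank_factor`). Moreover Q factors through ℂ^m, and reversing the two
factors gives AW, so Cline's formula computes Q^d (`isDrazinInv_fromBlocks_rank_factor`).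

Finally NUQ^d = 0, and U^(k+1) splits into a C-part, which gives the stated sum, and a corner
z^(k+1), which contributes only at k = 0.

Candidates are checked with an arbitrary absorbing exponent; `IsDrazinInv.unique` then identifies
them. The exact index matters only for T. -/

/-! ### Drazin inverses in monoids and rings -/

/-- `x` is a Drazin inverse of `a` in a monoid: it commutes with `a`, is an outer inverse of `a`,
and absorbs some power of `a`. -/
def IsDrazinInv {R : Type*} [Monoid R] (a x : R) : Prop :=
  a * x = x * a ∧ x * a * x = x ∧ ∃ k : ℕ, a ^ k = a ^ (k + 1) * x

theorem IsDrazinInv.pow_mul_pow {R : Type*} [Monoid R] {a x : R} (h : IsDrazinInv a x) (k : ℕ) :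
    a ^ k * x ^ (k + 1) = x := by
  induction k with
  | zero => simp
  | succ k ih =>
    calc a ^ (k + 1) * x ^ (k + 1 + 1) = a ^ k * (a * x * x) * x ^ k := by
          rw [pow_succ, pow_succ' x, pow_succ' x]; simp only [mul_assoc]
      _ = a ^ k * x ^ (k + 1) := by rw [h.1, h.2.1, mul_assoc, ← pow_succ']
      _ = x := ih

/-- Both x and y equal y a x: expand one of them as a^k x^(k+1), with k an exponent that the other
absorbs. -/
theorem IsDrazinInv.unique {R : Type*} [Monoid R] {a x y : R} (hx : IsDrazinInv a x)
    (hy : IsDrazinInv a y) : x = y := by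
  have cy : Commute a y := hy.1
  have e₁ : y * a * x = x := by
    obtain ⟨k, hk⟩ := hy.2.2
    have := hx.pow_mul_pow k
    calc y * a * x = y * a * (a ^ k * x ^ (k + 1)) := by rw [this]
      _ = y * a ^ (k + 1) * x ^ (k + 1) := by rw [pow_succ' a]; simp only [mul_assoc]
      _ = x := by rw [← (cy.pow_left (k + 1)).eq, ← hk, this]
  have e₂ : y * a * x = y := by
    obtain ⟨k, hk⟩ := hx.2.2
    have := hy.pow_mul_pow k
    rw [((cy.pow_pow k (k + 1))).eq] at this
    calc y * a * x = y ^ (k + 1) * a ^ k * a * x := by rw [this]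
      _ = y ^ (k + 1) * (a ^ (k + 1) * x) := by rw [pow_succ a]; simp only [mul_assoc]
      _ = y := by rw [← hk, this]
  exact e₁.symm.trans e₂

/-- A Drazin inverse is unaffected by adding an orthogonal nilpotent element. -/
theorem IsDrazinInv.add_nilpotent {R : Type*} [Ring R] {q s x : R} (h : IsDrazinInv q x)
    (hqs : q * s = 0) (hsq : s * q = 0) (hs : IsNilpotent s) : IsDrazinInv (q + s) x := by
  obtain ⟨h₁, h₂, k, hk⟩ := h
  obtain ⟨l, hl⟩ := hs
  have hxs : x * s = 0 := by rw [← h₂, mul_assoc x, h₁, mul_assoc, mul_assoc, hqs]; simp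
  have hsx : s * x = 0 := by rw [← h₂, ← h₁, ← mul_assoc, ← mul_assoc, hsq]; simp
  -- Only positive powers split this way: at exponent 0 the right side would be 2.
  have hpow : ∀ j : ℕ, (q + s) ^ (j + 1) = q ^ (j + 1) + s ^ (j + 1) := by
    intro j
    induction j with
    | zero => simp
    | succ j ih =>
      rw [pow_succ, ih, mul_add, add_mul, add_mul, pow_succ q j, pow_succ s j, mul_assoc _ q s,
        mul_assoc _ s q, hqs, hsq]
      simp [pow_succ]
  -- The exponent is at least k, at least l and positive: it absorbs x, kills s, and lets `hpow`
  -- apply.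
  refine ⟨by rw [add_mul, mul_add, hxs, hsx, h₁], by rw [mul_add, hxs, add_zero, h₂],
    k + l + 1, ?_⟩
  rw [hpow, hpow, add_mul, pow_succ s (k + l + 1), mul_assoc _ s x, hsx, mul_zero, add_zero,
    show k + l + 1 = l + 1 + k by ring, pow_add s, pow_succ s l, hl, add_assoc (l + 1) k 1,
    pow_add q (l + 1) k, pow_add q (l + 1) (k + 1), mul_assoc _ _ x, ← hk]
  simp

/-- The Drazin inverse of a sum `t + n` with `t * n = 0` and `n` group invertible. -/
theorem IsDrazinInv.add_of_mul_eq_zero {R : Type*} [Ring R] {t n r u : R} {g : ℕ}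
    (htn : t * n = 0) (h₁ : t * r = r * t) (h₂ : r * t * r = r)
    (hg : t ^ g = t ^ (g + 1) * r) (hu : n * u = u * n) (huu : u * n * u = u)
    (hn : n * u * n = n) :
    IsDrazinInv (t + n) ((1 - n * u) * r +
      ∑ k ∈ Finset.range (g + 1), u ^ (k + 1) * t ^ k * (1 - t * r)) := by
  set p := 1 - t * r with hp
  clear_value p
  set S := ∑ k ∈ Finset.range (g + 1), u ^ (k + 1) * t ^ k * p with hS
  have htgp : t ^ g * p = 0 := by
    rw [hp, mul_sub, mul_one, ← mul_assoc, ← pow_succ, ← hg, sub_self]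
  have htu : t * u = 0 := by rw [← huu, ← hu, ← mul_assoc, ← mul_assoc, htn]; simp
  have hrn : r * n = 0 := by rw [← h₂, mul_assoc r, h₁, mul_assoc, mul_assoc, htn]; simp
  have hnn : n * n * u = n := by rw [mul_assoc, hu, ← mul_assoc, hn]
  have hpt : p * t = t * p := by rw [hp, sub_mul, mul_sub, one_mul, mul_one, mul_assoc, ← h₁]
  have hpn : p * n = n := by rw [hp, sub_mul, mul_assoc, hrn]; simp
  have hptr : p * (t * r) = 0 := by
    rw [hp, sub_mul, one_mul, mul_assoc t, ← mul_assoc r, h₂, sub_self]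
  have htS : t * S = 0 := by
    rw [hS, Finset.mul_sum]
    refine Finset.sum_eq_zero fun k _ => ?_
    rw [pow_succ', ← mul_assoc, ← mul_assoc, ← mul_assoc, htu]; simp
  have hSn : S * n = u * n := by
    rw [hS, Finset.sum_mul, Finset.sum_range_succ', Finset.sum_eq_zero]
    · simp [mul_assoc, hpn]
    · intro k _
      rw [mul_assoc, hpn, pow_succ t, mul_assoc, mul_assoc, htn]; simp
  have hSp : S * p = S := by
    rw [hS, Finset.sum_mul]
    refine Finset.sum_congr rfl fun k _ => ?_
    rw [mul_assoc]; congr 1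
    conv_lhs => rw [hp, mul_sub, ← hp, hptr]
    simp
  have huS : n * u * S = S := by
    rw [hS, Finset.mul_sum]
    refine Finset.sum_congr rfl fun k _ => ?_
    rw [pow_succ', ← mul_assoc, ← mul_assoc, ← mul_assoc, hu, huu]
  -- Multiplying by n lowers the power of u by one, so n * S is S * t shifted by one index. The k =
  -- 0 term gives n * u * p, and the top term of S * t dies because t ^ g * p = 0.
  have hnS : n * S = n * u * p + S * t := by
    have e₁ : n * S = ∑ k ∈ Finset.range (g + 1), n * u ^ (k + 1) * t ^ k * p := by
      rw [hS, Finset.mul_sum]; simp only [mul_assoc]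
    have e₂ : S * t = ∑ k ∈ Finset.range g, u ^ (k + 1) * t ^ (k + 1) * p := by
      rw [hS, Finset.sum_mul, Finset.sum_range_succ, mul_assoc _ _ p, htgp]
      simp only [mul_zero, zero_mul, add_zero]
      refine Finset.sum_congr rfl fun k _ => ?_
      rw [mul_assoc, hpt, pow_succ t]; simp only [mul_assoc]
    rw [e₁, Finset.sum_range_succ', e₂, add_comm]
    congr 1
    · simp
    · refine Finset.sum_congr rfl fun k _ => ?_
      rw [pow_succ' u (k + 1), pow_succ' u k, ← mul_assoc, ← mul_assoc, hu, huu]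
  clear_value S
  set x := (1 - n * u) * r + S with hx
  clear_value x
  have hxn : x * n = u * n := by rw [hx, add_mul, mul_assoc, hrn, mul_zero, zero_add, hSn]
  have hax : (t + n) * x = t * r + n * S := by
    have e₁ : t * x = t * r := by
      rw [hx, mul_add, htS, add_zero, sub_mul, one_mul, mul_assoc n, mul_sub, ← mul_assoc t n,
        htn]; simp
    have e₂ : n * x = n * S := by
      rw [hx, mul_add, ← mul_assoc, mul_sub, mul_one, ← mul_assoc, hnn]; simp
    rw [add_mul, e₁, e₂]
  have hxa : x * (t + n) = t * r + n * S := by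
    rw [mul_add, hxn, hx, add_mul, hnS, mul_assoc, ← h₁, hp, hu]
    noncomm_ring
  -- The complementary idempotent 1 - (t + n) * x is p - n * S, and it intertwines t + n with t.
  -- Hence (t + n) ^ g carries it to (p - n * S) * t ^ g, which vanishes since S = S * p.
  have hmul : (t + n) * (p - n * S) = (p - n * S) * t := by
    have e : n * (n * S) = n * p + n * (S * t) := by
      conv_lhs => rw [hnS, mul_add, ← mul_assoc, ← mul_assoc, hnn]
    rw [add_mul, mul_sub, mul_sub, ← mul_assoc t n, htn, e, sub_mul, hpt, mul_assoc n]
    noncomm_ring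
  have hpowmul : ∀ j : ℕ, (t + n) ^ j * (p - n * S) = (p - n * S) * t ^ j := by
    intro j
    induction j with
    | zero => simp
    | succ j ih => rw [pow_succ, mul_assoc, hmul, ← mul_assoc, ih, mul_assoc, ← pow_succ]
  refine ⟨hax.trans hxa.symm, ?_, g, ?_⟩
  · have e₁ : x * (t * r) = (1 - n * u) * r := by
      rw [hx, add_mul, ← hSp, mul_assoc S, hptr, mul_zero, add_zero, mul_assoc _ r,
        ← mul_assoc r, h₂]
    rw [mul_assoc, hax, mul_add, e₁, ← mul_assoc x, hxn, ← hu, huS, hx]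
  · have cpt : p * t ^ g = t ^ g * p := (Commute.pow_right (show Commute p t from hpt) g).eq
    have e := hpowmul g
    rw [sub_mul, ← hSp, mul_assoc, mul_assoc, cpt, htgp] at e
    have e' : p - n * (S * p) = 1 - (t + n) * x := by rw [hax, hSp, hp]; abel
    rw [e', mul_sub, ← mul_assoc, ← pow_succ] at e
    rw [← sub_eq_zero, ← mul_one ((t + n) ^ g), e]; simp

/-! ### Cline's formula and nilpotent matrices -/

section Matrices

variable {ι κ : Type*} [Fintype ι] [DecidableEq ι] [Fintype κ] [DecidableEq κ]

/-- Cline's formula. -/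
theorem IsDrazinInv.cline {F : Matrix κ ι ℂ} {G : Matrix ι κ ℂ} {c : Matrix ι ι ℂ}
    (h : IsDrazinInv (G * F) c) : IsDrazinInv (F * G) (F * c ^ 2 * G) := by
  obtain ⟨h₁, h₂, k, hk⟩ := h
  have hp : ∀ j : ℕ, (F * G) ^ (j + 1) = F * (G * F) ^ j * G := by
    intro j
    induction j with
    | zero => simp
    | succ j ih => rw [pow_succ, ih, pow_succ]; simp only [Matrix.mul_assoc]
  have e₁ : G * F * c ^ 2 = c := by rw [pow_two, ← mul_assoc, h₁, h₂]
  have e₂ : c ^ 2 * (G * F) = c := by rw [pow_two, mul_assoc, ← h₁, ← mul_assoc, h₂]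
  have l : F * G * (F * c ^ 2 * G) = F * c * G := by
    calc _ = F * (G * F * c ^ 2) * G := by simp only [Matrix.mul_assoc]
      _ = _ := by rw [e₁]
  have r : F * c ^ 2 * G * (F * G) = F * c * G := by
    calc _ = F * (c ^ 2 * (G * F)) * G := by simp only [Matrix.mul_assoc]
      _ = _ := by rw [e₂]
  refine ⟨l.trans r.symm, ?_, k + 1, ?_⟩
  · rw [r]
    calc _ = F * (c * (G * F * c ^ 2)) * G := by simp only [Matrix.mul_assoc]
      _ = _ := by rw [e₁, pow_two]
  · rw [hp, pow_succ, mul_assoc, l, hp]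
    calc F * (G * F) ^ k * G = F * ((G * F) ^ (k + 1) * c) * G := by rw [← hk]
      _ = _ := by rw [pow_succ]; simp only [Matrix.mul_assoc]

theorem isDrazinInv_drazinInverse (A : Matrix ι ι ℂ) : IsDrazinInv A (drazinInverse A) :=
  ⟨(drazinInverse_spec A).1, (drazinInverse_spec A).2.1, _, (drazinInverse_spec A).2.2⟩

theorem IsDrazinInv.drazinInverse_eq {A X : Matrix ι ι ℂ} (h : IsDrazinInv A X) :
    drazinInverse A = X :=
  (isDrazinInv_drazinInverse A).unique h

theorem IsDrazinInv.isNilpotent_mul_one_sub {R : Type*} [Ring R] {a x : R}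
    (h : IsDrazinInv a x) : IsNilpotent (a * (1 - a * x)) := by
  obtain ⟨h₁, h₂, k, hk⟩ := h
  have hc : Commute a (1 - a * x) := by
    rw [Commute, SemiconjBy, mul_sub, sub_mul, mul_assoc a x, ← h₁]; simp
  refine ⟨k + 1, ?_⟩
  rw [hc.mul_pow, pow_succ' (1 - a * x), ← mul_assoc, mul_sub, mul_one, pow_succ' a k,
    mul_assoc a _ (a * x), ← mul_assoc _ a x, ← pow_succ, ← hk]
  simp

/-- Block lower triangular matrices with nilpotent diagonal blocks are nilpotent. -/
theorem isNilpotent_fromBlocks_zero₁₂ {A : Matrix ι ι ℂ} {C : Matrix κ ι ℂ} {D : Matrix κ κ ℂ}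
    (hA : IsNilpotent A) (hD : IsNilpotent D) : IsNilpotent (Matrix.fromBlocks A 0 C D) := by
  obtain ⟨a, ha⟩ := hA
  obtain ⟨d, hd⟩ := hD
  have hp : ∀ j : ℕ, ∃ E, Matrix.fromBlocks A 0 C D ^ j = Matrix.fromBlocks (A ^ j) 0 E (D ^ j) := by
    intro j
    induction j with
    | zero => exact ⟨0, by simp⟩
    | succ j ih =>
      obtain ⟨E, hE⟩ := ih
      exact ⟨E * A + D ^ j * C, by rw [pow_succ, hE, Matrix.fromBlocks_multiply]; simp [pow_succ]⟩
  obtain ⟨E, hE⟩ := hp (a + d)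
  refine ⟨a + d + (a + d), ?_⟩
  rw [pow_add, hE, pow_add A, pow_add D, ha, hd, Matrix.fromBlocks_multiply]
  simp

end Matrices

/-- Since y kills x + y from the left, each power of x + y is a power of x times a single x + y. -/
theorem isNilpotent_add_of_mul_eq_zero {R : Type*} [Ring R] {x y : R} (hx : IsNilpotent x)
    (hyx : y * x = 0) (hyy : y * y = 0) : IsNilpotent (x + y) := by
  obtain ⟨k, hk⟩ := hx
  have hp : ∀ j : ℕ, (x + y) ^ (j + 1) = x ^ j * (x + y) := by
    intro j
    induction j with
    | zero => simp
    | succ j ih =>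
      rw [pow_succ', ih, add_mul]
      cases j with
      | zero => simp [mul_add, hyx, hyy]
      | succ j =>
        rw [pow_succ' x j, ← mul_assoc y, ← mul_assoc y, hyx, pow_succ' x (j + 1), pow_succ' x j]
        simp [mul_assoc]
  exact ⟨k + 1, by rw [hp, hk, zero_mul]⟩

/-! ### Drazin inverses of Q and T -/

section BlockMatrices

variable {m n : ℕ}

/-- The block matrix is F * G with F = (1; Ca) and G = A(Aa)(1, aB), while G * F is the matrix
inverted by c. Cline's formula applies, and c absorbs the extra factor Aa. -/
theorem isDrazinInv_fromBlocks_rank_factor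
    {A a c : Matrix (Fin m) (Fin m) ℂ} {B : Matrix (Fin m) (Fin n) ℂ}
    {C : Matrix (Fin n) (Fin m) ℂ} (ha : A * a = a * A) (haa : a * A * a = a)
    (hc : IsDrazinInv (A * (A * a + a * B * C * a)) c) :
    IsDrazinInv (Matrix.fromBlocks (A ^ 2 * a) (A * a * B) (C * A * a) (C * a * B))
      (Matrix.fromRows 1 (C * a) * c ^ 2 * A * Matrix.fromCols 1 (a * B)) := by
  have hAa : A * a * (A * a) = A * a := by rw [mul_assoc, ← mul_assoc a, haa]
  have haAa : a * (A * a) = a := by rw [← mul_assoc, haa]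
  have hAaa : A * a * a = a := by rw [ha, haa]
  set F : Matrix (Fin m ⊕ Fin n) (Fin m) ℂ := Matrix.fromRows 1 (C * a) with hF
  set V : Matrix (Fin m) (Fin m ⊕ Fin n) ℂ := Matrix.fromCols 1 (a * B) with hV
  have hVF : V * F = 1 + a * B * C * a := by
    rw [hF, hV, Matrix.fromCols_mul_fromRows]; simp [Matrix.mul_assoc]
  have hW : A * (A * a + a * B * C * a) = A * (A * a) * V * F := by
    rw [Matrix.mul_assoc _ V, hVF, mul_add, mul_add, mul_one, Matrix.mul_assoc A, ]
    congr 2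
    calc a * B * C * a = A * a * a * B * C * a := by rw [hAaa]
      _ = _ := by simp only [Matrix.mul_assoc]
  have hWe : A * (A * a + a * B * C * a) * (A * a) = A * (A * a + a * B * C * a) := by
    rw [mul_assoc, add_mul, hAa, Matrix.mul_assoc _ a, haAa]
  -- c ends in a right factor A(Aa + aBCa), which Aa fixes from the right.
  have hce : c * (A * a) = c := by
    have : c * c * (A * (A * a + a * B * C * a)) = c := by
      rw [mul_assoc, ← hc.1, ← mul_assoc, hc.2.1]
    rw [← this, mul_assoc, hWe]
  have hcA : c ^ 2 * A = c ^ 2 * (A * (A * a)) := by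
    calc c ^ 2 * A = c * (c * (A * a)) * A := by rw [hce, pow_two]
      _ = c ^ 2 * (A * (a * A)) := by simp only [pow_two, mul_assoc]
      _ = _ := by rw [← ha]
  rw [hW] at hc
  have := hc.cline
  convert this using 1
  · rw [hF, hV, Matrix.mul_fromCols, Matrix.fromRows_mul_fromCols]
    have e : A * (A * a) * (a * B) = A * a * B := by
      calc _ = A * (A * a * a) * B := by simp only [Matrix.mul_assoc]
        _ = _ := by rw [hAaa]
    rw [e]
    congr 1
    · simp [pow_two, mul_assoc]
    · simp
    · calc C * A * a = C * (A * a * (A * a)) := by rw [hAa, Matrix.mul_assoc]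
        _ = C * (a * A * (A * a)) := by rw [ha]
        _ = _ := by simp only [Matrix.mul_assoc, mul_one]
    · calc C * a * B = C * (a * (A * a)) * B := by rw [haAa]
        _ = _ := by simp only [Matrix.mul_assoc]
  · rw [Matrix.mul_assoc F, hcA]
    simp only [Matrix.mul_assoc]

/-- Subtracting the matrix inverted by X leaves S, built from the parts of A and Z outside their
cores and from B, C compressed by the idempotent 1 - Aa. It is orthogonal to that matrix and
nilpotent, so it does not change the Drazin inverse. -/
theorem IsDrazinInv.fromBlocks_of_rank_factor
    {A a : Matrix (Fin m) (Fin m) ℂ} {B : Matrix (Fin m) (Fin n) ℂ}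
    {C : Matrix (Fin n) (Fin m) ℂ} {Z z : Matrix (Fin n) (Fin n) ℂ}
    {X : Matrix (Fin m ⊕ Fin n) (Fin m ⊕ Fin n) ℂ}
    (ha : IsDrazinInv A a) (hz : IsDrazinInv Z z)
    (hBZ : B * Z = 0) (hZCa : Z * C * a = 0) (hzCa : z * C * a = 0)
    (hABC : A * a * B * C = B * C) (hBCA : B * C * (A * a) = B * C)
    (h : IsDrazinInv
      (Matrix.fromBlocks (A ^ 2 * a) (A * a * B) (C * A * a) (C * a * B)) X) :
    IsDrazinInv (Matrix.fromBlocks A B ((1 - Z * z) * C) ((1 - Z * z) * (Z + C * a * B))) X := by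
  have ha₁ := ha.1
  have ha₂ := ha.2.1
  have hNA := ha.isNilpotent_mul_one_sub
  have hNZ := hz.isNilpotent_mul_one_sub
  have hBZ' : ∀ {l : ℕ} (Y : Matrix (Fin n) (Fin l) ℂ), B * (Z * Y) = 0 := fun Y => by
    rw [← Matrix.mul_assoc, hBZ, Matrix.zero_mul]
  have hZCAa : Z * (C * (A * a)) = 0 := by
    rw [ha₁, ← Matrix.mul_assoc, ← Matrix.mul_assoc, hZCa, Matrix.zero_mul]
  have hπCa : ∀ {l : ℕ} (Y : Matrix (Fin m) (Fin l) ℂ),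
      Z * (z * (C * (a * Y))) = 0 := fun Y => by
    rw [← Matrix.mul_assoc C, ← Matrix.mul_assoc z, ← Matrix.mul_assoc z C, hzCa]; simp
  have hE : A * a * (A * a) = A * a := by rw [mul_assoc, ← mul_assoc a, ha₂]
  have hAE : A * (A * a) = A * a * A := by rw [mul_assoc, ← ha₁]
  have hCE : (1 - Z * z) * (C * (A * a)) = C * (A * a) := by
    rw [ha₁, Matrix.sub_mul, Matrix.mul_assoc, hπCa]; simp
  have hCa : (1 - Z * z) * (C * a) = C * a := by
    have := hπCa (1 : Matrix (Fin m) (Fin m) ℂ)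
    rw [mul_one] at this
    rw [Matrix.sub_mul, Matrix.mul_assoc, this]; simp
  have hBπ : B * (1 - Z * z) = B := by rw [Matrix.mul_sub, hBZ', Matrix.mul_one, sub_zero]
  generalize hp : 1 - Z * z = p at *
  have hpZ : p * Z = Z * p := by rw [← hp, sub_mul, mul_sub, mul_assoc, ← hz.1]; simp
  set e := A * a with he
  set S : Matrix (Fin m ⊕ Fin n) (Fin m ⊕ Fin n) ℂ :=
    Matrix.fromBlocks (A * (1 - e)) ((1 - e) * B) (p * C * (1 - e)) (Z * p) with hS
  have hsum : Matrix.fromBlocks A B (p * C) (p * (Z + C * a * B)) =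
      Matrix.fromBlocks (A ^ 2 * a) (e * B) (C * A * a) (C * a * B) + S := by
    rw [hS, Matrix.fromBlocks_add]
    congr 1
    · rw [mul_sub, pow_two, mul_assoc A, ← he]; simp
    · rw [Matrix.sub_mul]; simp
    · rw [Matrix.mul_sub, Matrix.mul_assoc p C e, hCE, Matrix.mul_assoc C A, ← he, Matrix.mul_one]; abel
    · rw [Matrix.mul_add, ← Matrix.mul_assoc, hCa, hpZ, add_comm]
  rw [hsum]
  have e₀ : e * (1 - e) = 0 := by rw [mul_sub, hE]; simp
  have e₀' : (1 - e) * e = 0 := by rw [sub_mul, hE]; simp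
  have e₁ : e * (A * (1 - e)) = 0 := by rw [← mul_assoc, ← hAE, mul_assoc, e₀, mul_zero]
  have e₁' : A * (1 - e) * e = 0 := by rw [mul_assoc, e₀', mul_zero]
  have hBCe : B * (C * (1 - e)) = 0 := by
    rw [← Matrix.mul_assoc, Matrix.mul_sub, hBCA]; simp
  have heBC : (1 - e) * (B * C) = 0 := by
    rw [Matrix.sub_mul, ← Matrix.mul_assoc e, hABC]; simp
  have hBpC : B * (p * C * (1 - e)) = 0 := by
    rw [Matrix.mul_assoc, ← Matrix.mul_assoc B, hBπ, hBCe]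
  have hA2 : A ^ 2 * a = e * A := by rw [pow_two, mul_assoc, ← he, hAE]
  have hCA : C * A * a = C * e := Matrix.mul_assoc _ _ _
  refine h.add_nilpotent ?_ ?_ ?_
  · rw [hS, Matrix.fromBlocks_multiply, hA2, hCA]
    have t₁ : e * A * (A * (1 - e)) = 0 := by
      rw [← hAE, mul_assoc, e₁, mul_zero]
    have t₂ : e * A * ((1 - e) * B) = 0 := by
      rw [← hAE, Matrix.mul_assoc, ← Matrix.mul_assoc e, e₀]; simp
    have t₃ : C * e * (A * (1 - e)) = 0 := by rw [Matrix.mul_assoc, e₁, Matrix.mul_zero]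
    have t₄ : C * e * ((1 - e) * B) = 0 := by
      rw [Matrix.mul_assoc, ← Matrix.mul_assoc e, e₀]; simp
    rw [t₁, t₂, t₃, t₄, Matrix.mul_assoc e B, Matrix.mul_assoc e B, Matrix.mul_assoc _ B,
      Matrix.mul_assoc _ B, hBpC, hBZ']
    simp
  · rw [hS, Matrix.fromBlocks_multiply, hA2, hCA]
    have t₁ : A * (1 - e) * (e * A) = 0 := by rw [← mul_assoc, e₁', zero_mul]
    have t₂ : A * (1 - e) * (e * B) = 0 := by rw [← Matrix.mul_assoc, e₁', Matrix.zero_mul]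
    have t₃ : (1 - e) * B * (C * e) = 0 := by
      rw [← Matrix.mul_assoc, Matrix.mul_assoc _ B, heBC, Matrix.zero_mul]
    have t₄ : (1 - e) * B * (C * a * B) = 0 := by
      rw [Matrix.mul_assoc C, ← Matrix.mul_assoc, Matrix.mul_assoc _ B, heBC, Matrix.zero_mul]
    have t₅ : p * C * (1 - e) * (e * A) = 0 := by
      rw [Matrix.mul_assoc, ← Matrix.mul_assoc _ e, e₀']; simp
    have t₆ : p * C * (1 - e) * (e * B) = 0 := by
      rw [Matrix.mul_assoc, ← Matrix.mul_assoc _ e, e₀']; simp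
    have t₇ : Z * p * (C * e) = 0 := by rw [← hpZ, Matrix.mul_assoc, hZCAa, Matrix.mul_zero]
    have t₈ : Z * p * (C * a * B) = 0 := by
      rw [← hpZ, Matrix.mul_assoc, ← Matrix.mul_assoc, ← Matrix.mul_assoc, Matrix.mul_assoc p,
        Matrix.mul_assoc p, ← Matrix.mul_assoc Z, hZCa]
      simp
    rw [t₁, t₂, t₃, t₄, t₅, t₆, t₇, t₈]
    simp
  -- The diagonal blocks A(1 - Aa) and Z(1 - Zz) are nilpotent; the upper right corner squares to
  -- zero and kills the lower triangular part from the left, because BpC(1 - e) = 0 and BZ = 0.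
  · have hsplit : S = Matrix.fromBlocks (A * (1 - e)) 0 (p * C * (1 - e)) (Z * p) +
        Matrix.fromBlocks 0 ((1 - e) * B) 0 0 := by
      rw [hS, Matrix.fromBlocks_add]; simp
    rw [hsplit]
    refine isNilpotent_add_of_mul_eq_zero (isNilpotent_fromBlocks_zero₁₂ hNA hNZ) ?_ ?_
    · rw [Matrix.fromBlocks_multiply, Matrix.mul_assoc (1 - e) B, Matrix.mul_assoc (1 - e) B, hBpC,
        hBZ']
      simp
    · rw [Matrix.fromBlocks_multiply]; simp

end BlockMatrices

/-! ### The formula for M -/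

theorem corollary4p4 (m n : ℕ)
    (A : Matrix (Fin m) (Fin m) ℂ) (B : Matrix (Fin m) (Fin n) ℂ)
    (C : Matrix (Fin n) (Fin m) ℂ) (D : Matrix (Fin n) (Fin n) ℂ)
    (M Q Qd T : Matrix (Fin m ⊕ Fin n) (Fin m ⊕ Fin n) ℂ)
    (Z : Matrix (Fin n) (Fin n) ℂ) (W : Matrix (Fin m) (Fin m) ℂ) (g : ℕ)
    (hM : M = Matrix.fromBlocks A B C D)
    (hZ : Z = D - C * drazinInverse A * B)
    (hW : W = A * drazinInverse A + drazinInverse A * B * C * drazinInverse A)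
    (hQ : Q = Matrix.fromBlocks
      (A ^ 2 * drazinInverse A) (A * drazinInverse A * B)
      (C * A * drazinInverse A) (C * drazinInverse A * B))
    (hQd : Qd = Matrix.fromRows 1 (C * drazinInverse A) * drazinInverse (A * W) ^ 2 * A *
      Matrix.fromCols 1 (drazinInverse A * B))
    (hT : T = Matrix.fromBlocks A B (drazinPi Z * C) (drazinPi Z * D))
    (hg : g = matrixIndex T)
    (hBZ : B * Z = 0)
    (hZCA : Z * C * drazinInverse A = 0)
    (hABC : drazinPi A * B * C = 0)
    (hBCA : B * C * drazinPi A = 0) :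
    drazinInverse Q = Qd ∧
    drazinInverse M =
      Matrix.fromBlocks 0 0 0 (drazinInverse Z) + Qd +
        ∑ k ∈ Finset.range g,
          Matrix.fromBlocks 0 0 (drazinInverse Z ^ (k + 2) * C) 0 * T ^ k * (1 - T * Qd) := by
  have ha := isDrazinInv_drazinInverse A
  have hz := isDrazinInv_drazinInverse Z
  have hc := isDrazinInv_drazinInverse (A * W)
  have hTr := drazinInverse_spec T
  rw [IsDrazinInverse, ← hg] at hTr
  unfold drazinPi at hT hABC hBCA
  generalize drazinInverse A = a at *
  generalize drazinInverse (A * W) = c at *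
  generalize drazinInverse Z = z at *
  have hD : D = Z + C * a * B := by rw [hZ]; abel
  have hABC' : A * a * B * C = B * C := by
    rw [Matrix.sub_mul, Matrix.sub_mul, Matrix.one_mul, sub_eq_zero] at hABC
    exact hABC.symm
  have hBCA' : B * C * (A * a) = B * C := by
    rw [Matrix.mul_sub, Matrix.mul_one, sub_eq_zero] at hBCA
    exact hBCA.symm
  have hz₁ : Z * z = z * Z := hz.1
  have hz₂ : z * Z * z = z := hz.2.1
  have hzZz : Z * z * z = z := by rw [hz₁, hz₂]
  have hzzZ : z * z * Z = z := by rw [mul_assoc, ← hz₁, ← mul_assoc, hz₂]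
  have hzCa : z * C * a = 0 := by
    rw [← hzzZ, Matrix.mul_assoc, Matrix.mul_assoc, ← Matrix.mul_assoc Z, hZCA, Matrix.mul_zero]
  have hBz : B * z = 0 := by
    rw [← hzZz, mul_assoc, ← Matrix.mul_assoc, hBZ, Matrix.zero_mul]
  have hQD : IsDrazinInv Q Qd := by
    rw [hQ, hQd]
    rw [hW] at hc
    exact isDrazinInv_fromBlocks_rank_factor ha.1 ha.2.1 hc
  have hTD : IsDrazinInv T Qd := by
    rw [hT, hD]
    rw [hQ] at hQD
    exact ha.fromBlocks_of_rank_factor hz hBZ hZCA hzCa hABC' hBCA' hQD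
  refine ⟨hQD.drazinInverse_eq, ?_⟩
  -- `hTD` gives only some absorbing exponent; the defining equation at the index gives g itself,
  -- which bounds the sum.
  rw [hTD.drazinInverse_eq] at hTr
  obtain ⟨hT₁, hT₂, hTg⟩ := hTr
  set N : Matrix (Fin m ⊕ Fin n) (Fin m ⊕ Fin n) ℂ :=
    Matrix.fromBlocks 0 0 (Z * z * C) (Z * z * Z) with hN
  set U : Matrix (Fin m ⊕ Fin n) (Fin m ⊕ Fin n) ℂ :=
    Matrix.fromBlocks 0 0 (z ^ 2 * C) z with hU
  set J : Matrix (Fin m ⊕ Fin n) (Fin m ⊕ Fin n) ℂ := Matrix.fromBlocks 0 0 0 z with hJ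
  have hzπ : z * (1 - Z * z) = 0 := by rw [mul_sub, ← mul_assoc, hz₂]; simp
  have hπz : (1 - Z * z) * z = 0 := by rw [sub_mul, hzZz]; simp
  -- On the core of Z the blocks D and Z agree from both sides, as zCa = 0 and Bz = 0.
  have hzD : z * D = z * Z := by
    rw [hD, Matrix.mul_add, ← Matrix.mul_assoc, ← Matrix.mul_assoc, hzCa]; simp
  have hDz : D * z = Z * z := by
    rw [hD, Matrix.add_mul, Matrix.mul_assoc _ B, hBz]; simp
  have hMTN : M = T + N := by
    rw [hM, hT, hN, Matrix.fromBlocks_add, add_zero, add_zero]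
    congr 1
    · rw [Matrix.sub_mul]; simp
    · rw [Matrix.sub_mul, Matrix.mul_assoc Z z D, hzD]; simp [Matrix.mul_assoc]
  have hTN : T * N = 0 := by
    have e : (1 - Z * z) * D * (Z * z) = 0 := by
      rw [mul_assoc, hz₁, ← mul_assoc D, hDz, ← hz₁, hz₁, ← mul_assoc, ← mul_assoc, ← hz₁, hπz]
      simp
    have e' : B * (Z * z) = 0 := by rw [← Matrix.mul_assoc, hBZ, Matrix.zero_mul]
    rw [hT, hN, Matrix.fromBlocks_multiply, ← Matrix.mul_assoc _ _ C, ← Matrix.mul_assoc _ _ C,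
      ← Matrix.mul_assoc B _ Z, ← Matrix.mul_assoc _ _ Z, e, e']
    simp
  have hJT : J * T = 0 := by
    rw [hJ, hT, Matrix.fromBlocks_multiply, ← Matrix.mul_assoc z, ← Matrix.mul_assoc z, hzπ]
    simp
  have hZzC : Z * z * (z ^ 2 * C) = z ^ 2 * C := by
    rw [← Matrix.mul_assoc, pow_two, ← mul_assoc, hzZz]
  have hNU : N * U = Matrix.fromBlocks 0 0 (z * C) (Z * z) := by
    rw [hN, hU, Matrix.fromBlocks_multiply]
    have e₁ : Z * z * Z * (z ^ 2 * C) = z * C := by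
      rw [← Matrix.mul_assoc, pow_two, mul_assoc _ Z, ← mul_assoc Z, hzZz, hzZz]
    have e₂ : Z * z * Z * z = Z * z := by rw [mul_assoc, mul_assoc, ← mul_assoc z, hz₂]
    rw [e₁, e₂]; simp
  have hUN : U * N = Matrix.fromBlocks 0 0 (z * C) (Z * z) := by
    rw [hN, hU, Matrix.fromBlocks_multiply]
    have e₁ : z * (Z * z * C) = z * C := by
      rw [← Matrix.mul_assoc, ← mul_assoc, hz₂]
    have e₂ : z * (Z * z * Z) = Z * z := by rw [← mul_assoc, ← mul_assoc, hz₂, hz₁]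
    rw [e₁, e₂]; simp
  have hUNU : U * N * U = U := by
    rw [hUN, hU, Matrix.fromBlocks_multiply, hZzC, hzZz]; simp
  have hNUN : N * U * N = N := by
    rw [hNU, hN, Matrix.fromBlocks_multiply]
    have e : Z * z * (Z * z) = Z * z := by rw [mul_assoc, ← mul_assoc z, hz₂]
    rw [← mul_assoc, ← Matrix.mul_assoc (Z * z), e]; simp
  have key := (IsDrazinInv.add_of_mul_eq_zero hTN hT₁ hT₂ hTg (hNU.trans hUN.symm) hUNU
    hNUN).drazinInverse_eq
  rw [← hMTN] at key
  -- AW has a as a left factor, hence so does c = AWcc, and zCa = 0 then kills the only surviving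
  -- row.
  have hNUQd : N * U * Qd = 0 := by
    have e₁ : Z * z * (C * a) = 0 := by
      rw [← Matrix.mul_assoc, Matrix.mul_assoc Z, Matrix.mul_assoc, hzCa, Matrix.mul_zero]
    have e₂ : z * C * c ^ 2 = 0 := by
      have hAW : A * W = a * (A * A + A * B * C * a) := by
        rw [hW, mul_add, mul_add, ← mul_assoc a, ← ha.1, mul_assoc A a A, ← ha.1]
        simp only [← Matrix.mul_assoc, ← ha.1]
      have hc' : c = a * (A * A + A * B * C * a) * c * c := by rw [← hAW, hc.1, hc.2.1]
      have : z * C * c = 0 := by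
        rw [hc']
        simp only [← Matrix.mul_assoc]
        rw [hzCa]; simp
      rw [pow_two, ← Matrix.mul_assoc, this, Matrix.zero_mul]
    rw [hNU, hQd, Matrix.mul_assoc _ A, Matrix.mul_assoc _ (c ^ 2), ← Matrix.mul_assoc,
      Matrix.fromBlocks_mul_fromRows, e₁, Matrix.fromRows_mul, add_zero, Matrix.mul_one (z * C),
      ← Matrix.mul_assoc (z * C) (c ^ 2), e₂]
    simp
  have hUpow : ∀ k : ℕ, U ^ (k + 1) = Matrix.fromBlocks 0 0 (z ^ (k + 2) * C) 0 + J ^ (k + 1) := by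
    intro k
    have hJp : ∀ j : ℕ, J ^ (j + 1) = Matrix.fromBlocks 0 0 0 (z ^ (j + 1)) := by
      intro j
      induction j with
      | zero => simp [hJ]
      | succ j ih => rw [pow_succ, ih, hJ, Matrix.fromBlocks_multiply]; simp [pow_succ]
    rw [hJp]
    induction k with
    | zero => simp [hU, Matrix.fromBlocks_add]
    | succ k ih =>
      rw [pow_succ', ih, hU, Matrix.fromBlocks_add, Matrix.fromBlocks_add,
        Matrix.fromBlocks_multiply]
      simp only [add_zero, zero_add, Matrix.mul_zero, Matrix.zero_mul]
      rw [← Matrix.mul_assoc, ← pow_succ', ← pow_succ']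
  have hTp : T ^ g * (1 - T * Qd) = 0 := by
    rw [mul_sub, mul_one, ← mul_assoc, ← pow_succ, ← hTg, sub_self]
  -- As JT = 0, only k = 0 survives, where J(1 - T * Qd) = J.
  have hJsum : ∑ k ∈ Finset.range (g + 1), J ^ (k + 1) * T ^ k * (1 - T * Qd) = J := by
    rw [Finset.sum_range_succ', Finset.sum_eq_zero]
    · rw [mul_sub, pow_zero, mul_one, mul_one, ← mul_assoc, zero_add, pow_one, hJT]; simp
    · intro k _
      rw [pow_succ J, pow_succ' T, mul_assoc _ J, ← mul_assoc J, hJT]; simp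
  rw [key, sub_mul, hNUQd]
  simp only [hUpow, add_mul, Finset.sum_add_distrib]
  -- The extra term k = g vanishes by `hTp`, leaving the sum up to g - 1.
  rw [hJsum, Finset.sum_range_succ, mul_assoc _ (T ^ g), hTp, mul_zero, add_zero]
  simp only [one_mul, sub_zero]
  abel
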